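/- Let $\mathbb{Z}_2\wr\mathbb{Z}$ be the lamplighter group (restricted wreath product: pairs $(f,b)$ with $f:\mathbb{Z}\to\mathbb{Z}_2$ finitely supported, $b\in\mathbb{Z}$, and $(f,b)(f',b')=(x\mapsto f(x)+f'(x-b),\,b+b')$). Let $t=(0,1)$, let $h=(\delta_0,0)$, let $Q_1=\{t,th,ht,hth\}$ and $S_1=Q_1\cup Q_1^{-1}$. Write $g(n)\asymp f(n)$ if there are constants $\delta_2\ge\delta_1>0$ with $\delta_1 f(n)\le g(n)\le\delta_2 f(n)$ for all $n\ge 1$. A $(k+1)$-tape Turing transducer is a deterministic Turing machine with one input tape and $k$ read-write output tapes, all one-way infinite. Let $\mathcal{T}$ be the class of those Turing transducers, over a finite alphabet $\Sigma$, which on every input $x\in\Sigma^*$ work as follows: initially the output tapes are blank and all heads are over the leftmost cells; all heads move synchronously to the right until the end of $x$ and then at most $c$ further steps to the right ($c$ depends only on the machine); then all heads move synchronously to the left until the machine enters a final state with all heads over the leftmost cells. Let $L$ be the set of accepted inputs; it is required that for $w\in L$ the contents of the output tapes at the end are words $w_1,\dots,w_k\in L$, called the outputs for $w$. We say that $T\in\mathcal{T}$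 presents the Cayley graph $\Gamma(G,S)$, $S=\{s_1,\dots,s_k\}$ (with edges $g\to gs_j$ labelled $j$), if there is a bijection $\psi:L\to G$ such that $\psi(w_j)=\psi(w)s_j$ for all $w\in L$ and all $j$. For $w_0\in L$ let $M_0=\{w_0\}$ and let $M_{n+1}$ be the multiset of all outputs for all elements of the multiset $M_n$ (with multiplicities). Let $\ell_n$ be the average length of the $k^n$ words of $M_n$, and let $b_n$ be the number of distinct words in $M_0\cup\dots\cup M_n$. Then $S_1$ is a generating set of $\mathbb{Z}_2\wr\mathbb{Z}$ with $8$ elements, and the following hold. (a) Let $\mu$ be the uniform measure on $S_1$, $\mu^{*n}$ its $n$-fold convolution (the distribution after $n$ steps of the simple random walk on $\Gamma(\mathbb{Z}_2\wr\mathbb{Z},S_1)$ started at the identity) and $\ell_{S_1}$ the word length with respect to $S_1$. Then $E_{\mu^{*n}}[\ell_{S_1}]\asymp\sqrt n$. (b) For every ordering $s_1,\dots,s_8$ of $S_1$ there is a $9$-tape Turing transducer $T_1\in\mathcal{T}$ that presents $\Gamma(\mathbb{Z}_2\wr\mathbb{Z},S_1)$ and such that, for every choice of $w_0\in L$ (with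 constants that may depend on $w_0$), $\ell_n\asymp\sqrt n$ and the growth function $b_n$ is exponential, i.e. $c\,\alpha^n\le b_n\le C\beta^n$ for all $n\ge 0$, with some constants $\alpha,\beta>1$ and $c,C>0$. -/

import Mathlib

open scoped Pointwise

/-! ### Turing transducers -/

/-- The possible moves of a head. -/
inductive Move where
  | left
  | stay
  | right

/-- The effect of a move on a head of a one-way infinite tape, whose cells are numbered
`0, 1, 2, …` from the left; a head cannot leave the tape over its left end. -/
def Move.apply : Move → ℕ → ℕ
  | .left, p => p - 1
  | .stay, p => p
  | .right, p => p + 1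

/-- A deterministic `(k+1)`-tape Turing transducer over the alphabet `A`: a finite-state machine
with one (read-only) input tape and `k` read-write output tapes, each tape with its own head.
A cell of the input tape is blank (`none`) or holds a letter of `A`; a cell of an output tape is
blank (`none`) or holds a letter of `A` or one of finitely many auxiliary symbols. -/
structure TuringTransducer (A : Type) (k : ℕ) where
  /-- states -/
  State : Type
  finite_state : Finite State
  /-- auxiliary tape symbols -/
  Aux : Type
  finite_aux : Finite Aux
  /-- the initial state -/
  start : State
  /-- the final states, in which the machine stops -/
  final : Set State
  /-- the accepting states -/
  accepting : Set State
  /-- new state, from the current state and the scanned symbols -/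
  next : State → Option A → (Fin k → Option (A ⊕ Aux)) → State
  /-- symbols written on the output tapes -/
  write : State → Option A → (Fin k → Option (A ⊕ Aux)) → Fin k → Option (A ⊕ Aux)
  /-- move of the head of the input tape -/
  moveIn : State → Option A → (Fin k → Option (A ⊕ Aux)) → Move
  /-- moves of the heads of the output tapes -/
  moveOut : State → Option A → (Fin k → Option (A ⊕ Aux)) → Fin k → Move

namespace TuringTransducer

variable {A : Type} {k : ℕ}

/-- A configuration of the machine (the input tape never changes and is not part of it). -/
@[ext] structure Config (T : TuringTransducer A k) where
  state : T.State
  headIn : ℕ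
  headOut : Fin k → ℕ
  tape : Fin k → ℕ → Option (A ⊕ T.Aux)

/-- Initially all heads are over the leftmost cells and the output tapes are blank. -/
def init (T : TuringTransducer A k) : T.Config where
  state := T.start
  headIn := 0
  headOut := fun _ => 0
  tape := fun _ _ => none

/-- One step of the machine on the input `x`, which is written in the cells `0, …, |x| - 1` of the
input tape. -/
def step (T : TuringTransducer A k) (x : List A) (c : T.Config) : T.Config :=
  let a : Option A := x[c.headIn]?
  let b : Fin k → Option (A ⊕ T.Aux) := fun i => c.tape i (c.headOut i)
  { state := T.next c.state a b
    headIn := (T.moveIn c.state a b).apply c.headIn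
    headOut := fun i => (T.moveOut c.state a b i).apply (c.headOut i)
    tape := fun i => Function.update (c.tape i) (c.headOut i) (T.write c.state a b i) }

/-- The configuration after `n` steps on the input `x` (meaningful until a final state is
entered). -/
def run (T : TuringTransducer A k) (x : List A) (n : ℕ) : T.Config :=
  (T.step x)^[n] T.init

/-- On the input `x` the machine stops after exactly `n` steps. -/
def HaltsAt (T : TuringTransducer A k) (x : List A) (n : ℕ) : Prop :=
  (T.run x n).state ∈ T.final ∧ ∀ i < n, (T.run x i).state ∉ T.final

/-- The language of the inputs that the machine accepts. -/
def language (T : TuringTransducer A k) : Set (List A) :=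
  {x | ∃ n, T.HaltsAt x n ∧ (T.run x n).state ∈ T.accepting}

/-- The machine accepts `x` and stops with exactly the word `y i` on the `i`-th output tape (from
the leftmost cell on, followed by blanks), for every `i`. -/
def Translates (T : TuringTransducer A k) (x : List A) (y : Fin k → List A) : Prop :=
  ∃ n, T.HaltsAt x n ∧ (T.run x n).state ∈ T.accepting ∧
    ∀ i p, (T.run x n).tape i p = ((y i)[p]?).map Sum.inl

/-- The special class of transducers. There is a bound `c` such that on every input `x` all heads
first move synchronously to the right, `|x| + m` times with `m ≤ c`, and then synchronously to the
left until the machine stops with all heads over the leftmost cells; it may stop as soon as the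
heads arrive there, or after one further step made on the leftmost cells. (At time `i` the heads
are over cell `i` on the way to the right and over cell `2 * (|x| + m) - i` on the way back.)
Moreover every accepted input is translated into words that are accepted. -/
def InClass (T : TuringTransducer A k) : Prop :=
  (∃ c : ℕ, ∀ x : List A, ∃ m ≤ c, ∃ n,
    (n = 2 * (x.length + m) ∨ n = 2 * (x.length + m) + 1) ∧
    T.HaltsAt x n ∧
    ∀ i ≤ n,
      (T.run x i).headIn = min i (2 * (x.length + m) - i) ∧
      ∀ j, (T.run x i).headOut j = min i (2 * (x.length + m) - i)) ∧
  ∀ x ∈ T.language, ∃ y, T.Translates x y ∧ ∀ j, y j ∈ T.language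

open Classical in
/-- The outputs of the machine for `w` (empty words if `w` is not translated into anything). -/
noncomputable def output (T : TuringTransducer A k) (w : List A) : Fin k → List A :=
  if h : ∃ y, T.Translates w y then h.choose else fun _ => []

/-- The sets `W₀ = {w₀}`, `Wₙ₊₁ = T(Wₙ)`. -/
def wordSet (T : TuringTransducer A k) (w₀ : List A) : ℕ → Set (List A)
  | 0 => {w₀}
  | n + 1 => {v | ∃ w ∈ T.wordSet w₀ n, ∃ j, T.output w j = v}

/-- The growth function `bₙ = #(W₀ ∪ ⋯ ∪ Wₙ)` of the pair `(T, w₀)`. -/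
noncomputable def growth (T : TuringTransducer A k) (w₀ : List A) (n : ℕ) : ℕ :=
  (⋃ i ∈ Set.Iic n, T.wordSet w₀ i).ncard

/-- The multisets `M₀ = {w₀}`, `Mₙ₊₁ = T(Mₙ)`. -/
noncomputable def wordMultiset (T : TuringTransducer A k) (w₀ : List A) : ℕ → Multiset (List A)
  | 0 => {w₀}
  | n + 1 => (T.wordMultiset w₀ n).bind fun w => (Finset.univ : Finset (Fin k)).val.map (T.output w)

/-- The average length growth function `ℓₙ` of the pair `(T, w₀)`: the average length of the words
of the multiset `Mₙ`, which has `kⁿ` elements. -/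
noncomputable def avgLength (T : TuringTransducer A k) (w₀ : List A) (n : ℕ) : ℝ :=
  (((T.wordMultiset w₀ n).map List.length).sum : ℝ) / (k : ℝ) ^ n

/-- The labelled directed graph of the machine, as the relation "there is an edge labelled `j` from
`u` to `v`" on the accepted words. -/
def Edge (T : TuringTransducer A k) (j : Fin k) (u v : T.language) : Prop :=
  ∃ w : Fin k → List A, T.Translates u w ∧ w j = v

/-- The machine presents the Cayley graph of `G` with respect to the generators `s 0, …, s (k-1)`
(edges `g → g * s j` labelled `j`): the two labelled directed graphs are isomorphic. -/
def Presents {G : Type*} [Group G] (T : TuringTransducer A k) (s : Fin k → G) : Prop :=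
  ∃ ψ : T.language ≃ G, ∀ j u v, T.Edge j u v ↔ ψ v = ψ u * s j

end TuringTransducer

/-! ### Asymptotics -/

/-- `g(n) ≍ f(n)`, for `n = 1, 2, …`. -/
def Asymp (g f : ℕ → ℝ) : Prop :=
  ∃ δ₁ δ₂ : ℝ, 0 < δ₁ ∧ δ₁ ≤ δ₂ ∧ ∀ n, 1 ≤ n → δ₁ * f n ≤ g n ∧ g n ≤ δ₂ * f n

/-- The sequence `b` grows exponentially. -/
def ExponentialGrowth (b : ℕ → ℕ) : Prop :=
  ∃ α β c C : ℝ, 1 < α ∧ 1 < β ∧ 0 < c ∧ 0 < C ∧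
    ∀ n, c * α ^ n ≤ b n ∧ (b n : ℝ) ≤ C * β ^ n

/-! ### Word length and simple random walks -/

section RandomWalk

variable {G : Type*} [Group G]

/-- The minimal length of a word over `S` that represents `g`. -/
noncomputable def wordLength (S : Finset G) (g : G) : ℕ :=
  sInf {n | ∃ l : List G, l.length = n ∧ (∀ a ∈ l, a ∈ S) ∧ l.prod = g}

/-- The ball of radius `n` around the identity. -/
def wordBall (S : Finset G) (n : ℕ) : Set G :=
  {g | wordLength S g ≤ n}

open Classical in
/-- The uniform probability measure on `S`. -/
noncomputable def stepMeasure (S : Finset G) (g : G) : ℝ :=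
  if g ∈ S then 1 / (S.card : ℝ) else 0

open Classical in
/-- The `n`-fold convolution `μ^{*n}(g) = ∑_{g = g₁ ⋯ gₙ} μ(g₁) ⋯ μ(gₙ)`, `gᵢ ∈ S`, of the uniform
measure `μ` on `S`: the distribution of the simple random walk after `n` steps. -/
noncomputable def convPow (S : Finset G) (n : ℕ) (g : G) : ℝ :=
  ∑ w : Fin n → S with (List.ofFn fun i => (w i : G)).prod = g, ∏ i, stepMeasure S (w i : G)

/-- `E_{μ^{*n}}[ℓ_S]`: the average of the word length over the ball of radius `n` with respect to
`μ^{*n}`. (For finite `S` that generates `G` as a monoid, the ball is finite.) -/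
noncomputable def drift (S : Finset G) (n : ℕ) : ℝ :=
  ∑ᶠ g ∈ wordBall S n, (wordLength S g : ℝ) * convPow S n g

end RandomWalk

/-! ### The lamplighter group -/

/-- The restricted wreath product `A ≀ B`: the pairs `(f, b)` with `f : B → A` of finite support
and `b : B`, multiplied by `(f, b) (f', b') = (x ↦ f x * f' (b⁻¹ * x), b * b')`. -/
def restrictedWreath (A B : Type) [Group A] [Group B] : Subgroup (A ≀ᵣ B) where
  carrier := {x | (Function.mulSupport x.left).Finite}
  one_mem' := by simp
  mul_mem' := by
    intro x y hx hy
    refine (hx.union (hy.image fun z => x.right * z)).subset ?_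
    intro z hz
    by_contra h
    simp only [Set.mem_union, not_or, Function.mem_mulSupport, not_not, Set.mem_image,
      not_exists, not_and] at h
    apply hz
    have h2 : y.left (x.right⁻¹ * z) = 1 := by
      by_contra h3
      exact h.2 _ h3 (by group)
    simp [h.1, h2]
  inv_mem' := by
    intro x hx
    refine (hx.image fun z => x.right⁻¹ * z).subset ?_
    intro z hz
    refine ⟨x.right * z, ?_, by group⟩
    intro h
    apply hz
    simp [h]

/-- The lamplighter group `ℤ₂ ≀ ℤ`. -/
abbrev Lamplighter : Type :=
  restrictedWreath (Multiplicative (ZMod 2)) (Multiplicative ℤ)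

namespace Lamplighter

/-- The generator `t` of the subgroup `ℤ`. -/
def t : Lamplighter :=
  ⟨⟨1, Multiplicative.ofAdd 1⟩, by simp [restrictedWreath]⟩

/-- The element `h`: the function with the value `a`, the nontrivial element of `ℤ₂`, at the
identity of `ℤ`, and trivial values elsewhere. -/
def h : Lamplighter :=
  ⟨⟨Pi.mulSingle 1 (Multiplicative.ofAdd 1), 1⟩,
    (Set.finite_singleton 1).subset Pi.mulSupport_mulSingle_subset⟩

open Classical in
/-- The generators `Q₁ = {t, th, ht, hth}`. -/
noncomputable def Q₁ : Finset Lamplighter := {t, t * h, h * t, h * t * h}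

open Classical in
/-- `S₁ = Q₁ ∪ Q₁⁻¹`. -/
noncomputable def S₁ : Finset Lamplighter := Q₁ ∪ Q₁⁻¹

end Lamplighter

/-! ### Determinism of outputs -/

namespace TuringTransducer

variable {A : Type} {k : ℕ}

/-- The halting time is the first time at which a final state is entered. -/
theorem HaltsAt.unique {T : TuringTransducer A k} {x : List A} {m n : ℕ}
    (hm : T.HaltsAt x m) (hn : T.HaltsAt x n) : m = n := by
  rcases lt_trichotomy m n with h | h | h
  · exact absurd hm.1 (hn.2 m h)
  · exact h
  · exact absurd hn.1 (hm.2 n h)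

/-! Every element of `S₁` has the form `gen e α β`: switch the lamp underfoot by `α`, step by `±1`,
switch the lamp arrived at by `β`. Hence the position of the walk is a simple random walk on `ℤ`,
and a walker moving steadily to the right can leave any pattern of lamps behind.

Word length and length of the encoding are both at least `|pos g|`, and both are at most linear in
any radius `M` with `Within M g` (`abs_pos_le_wordLength`, `Within.wordLength_le`, `abs_pos_le_len`,
`Within.len_le`). Along a walk such a radius grows only when the position sets a new record. So it
suffices that the mean distance of the position from the start is at least of order `√n`, which
follows from second and fourth moments (`le_markov_iterate`), and that the mean running maximum is
at most of order `√n`, a Doob type inequality proved by a quadratic potential (`maximalForm_step`,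
`markov_iterate_le`). Both bounds concern iterates of the Markov operator, which compute the drift
(`drift_eq_markov`) as well as the average output length (`sum_wordMultiset`).

For the transducer, `ℤ` is folded at the origin into a half-line, so that an element becomes a word
whose letters describe two integers each. Right multiplication by a generator changes this word by a
rule of radius one and its length by at most one (`localImage_encode`), and the encodings form a
regular language. One pass to the right and one back suffice for any such rule (`sweep`). Growth is
exponential because each word has eight outputs, while walks to the right with free lamps already
give `2 ^ n` elements. -/

theorem Translates.unique {T : TuringTransducer A k} {x : List A} {y z : Fin k → List A}
    (hy : T.Translates x y) (hz : T.Translates x z) : y = z := by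
  obtain ⟨m, hm, -, hy⟩ := hy
  obtain ⟨n, hn, -, hz⟩ := hz
  obtain rfl := hm.unique hn
  funext i
  refine List.ext_getElem? fun p => ?_
  exact Option.map_injective Sum.inl_injective ((hy i p).symm.trans (hz i p))

theorem Translates.output_eq {T : TuringTransducer A k} {x : List A} {y : Fin k → List A}
    (hy : T.Translates x y) : T.output x = y := by
  have h : ∃ y, T.Translates x y := ⟨y, hy⟩
  rw [output, dif_pos h]
  exact h.choose_spec.unique hy

/-! ### Transducers from local maps -/

/-- The letter of `x` to the left of the cell `p`. -/
def prevLetter (x : List A) (p : ℕ) : Option A := if p = 0 then none else x[p - 1]?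

/-- The value at the cell `p` of the image of `x` under a local map of radius one. -/
def localImage (F : Option A → Option A → Option A → Option A) (x : List A) (p : ℕ) : Option A :=
  if p ≤ x.length then F (prevLetter x p) x[p]? x[p + 1]? else none

variable {σ : Type}

/-- The transducer that accepts the language of the automaton `M` and applies the local map `F j`
on the `j`-th output tape. On the way to the right it runs `M` and writes into each cell the
preceding letter of the input, on the way back it evaluates the local maps. -/
def sweep [Finite A] [Finite σ] (M : DFA A σ)
    (F : Fin k → Option A → Option A → Option A → Option A) (j₀ : Fin k) :
    TuringTransducer A k where
  State := (σ × Option A) ⊕ (σ × Option A) ⊕ σ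
  finite_state := inferInstance
  Aux := Option A
  finite_aux := inferInstance
  start := .inl (M.start, none)
  final := Set.range fun q => .inr (.inr q)
  accepting := (fun q => .inr (.inr q)) '' M.accept
  next s a b := match s, a with
    | .inl (q, _), some c => .inl (M.step q c, some c)
    -- On the empty input the end of the word is already the leftmost cell.
    | .inl (q, none), none => .inr (.inr q)
    | .inl (q, some _), none => .inr (.inl (q, none))
    -- The leftmost cell is recognised by its mark, the only one that records no preceding letter.
    -- All tapes carry the same marks, so a single tape `j₀` is consulted.
    | .inr (.inl (q, _)), a => match b j₀ with
      | some (.inr (some _)) => .inr (.inl (q, a))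
      | _ => .inr (.inr q)
    | .inr (.inr q), _ => .inr (.inr q)
  write s a b j := match s, a with
    | .inl (_, u), some _ => some (.inr u)
    | .inl (_, u), none => (F j u none none).map .inl
    | .inr (.inl (_, v)), a => match b j with
      | some (.inr u) => (F j u a v).map .inl
      | z => z
    | .inr (.inr _), _ => b j
  moveIn s a _ := match s, a with
    | .inl _, some _ => .right
    | _, _ => .left
  moveOut s a _ _ := match s, a with
    | .inl _, some _ => .right
    | _, _ => .left

theorem run_succ (T : TuringTransducer A k) (x : List A) (n : ℕ) :
    T.run x (n + 1) = T.step x (T.run x n) := by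
  simp only [run, Function.iterate_succ_apply']

section sweep

variable [Finite A] [Finite σ] (M : DFA A σ)
  (F : Fin k → Option A → Option A → Option A → Option A) (j₀ : Fin k) (x : List A)

theorem sweep_run_right (i : ℕ) (hi : i ≤ x.length) :
    (sweep M F j₀).run x i =
      { state := .inl (M.eval (x.take i), prevLetter x i)
        headIn := i
        headOut := fun _ => i
        tape := fun _ p => if p < i then some (.inr (prevLetter x p)) else none } := by
  induction i with
  | zero => rfl
  | succ i ih =>
    have hlt : i < x.length := hi
    rw [run_succ, ih hlt.le]
    have hx : x[i]? = some x[i] := List.getElem?_eq_getElem hlt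
    ext1
    · have ht : x.take (i + 1) = x.take i ++ [x[i]] := by simp
      rw [ht, DFA.eval_append_singleton]
      simp only [step, sweep, hx, prevLetter, Nat.add_sub_cancel, if_neg (Nat.succ_ne_zero i)]
    · simp [step, hx, sweep, Move.apply]
    · simp [step, hx, sweep, Move.apply]
    · funext j p
      simp only [step, hx, sweep, Function.update_apply]
      rcases lt_trichotomy p i with h | h | h
      · rw [if_neg h.ne, if_pos h, if_pos (by omega)]
      · subst h; simp
      · rw [if_neg h.ne', if_neg (by omega), if_neg (by omega)]

/-- At each cell the rule needs three letters: the preceding one was deposited on the output tape,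
the present one is on the input tape, and the next one has just been passed and is kept in the
state. -/
theorem sweep_run_left (d : ℕ) (hd : d < x.length) :
    (sweep M F j₀).run x (x.length + 1 + d) =
      { state := .inr (.inl (M.eval x, x[x.length - d]?))
        headIn := x.length - 1 - d
        headOut := fun _ => x.length - 1 - d
        tape := fun j p => if x.length - 1 - d < p then (localImage (F j) x p).map .inl
          else some (.inr (prevLetter x p)) } := by
  induction d with
  | zero =>
    rw [Nat.add_zero, run_succ, sweep_run_right M F j₀ x _ le_rfl]
    have hx : x[x.length]? = none := by simp
    have hx' : prevLetter x x.length = some x[x.length - 1] := by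
      rw [prevLetter, if_neg (by omega), List.getElem?_eq_getElem]
    ext1
    · simp [step, hx', sweep]
    · simp [step, sweep, Move.apply]
    · simp [step, sweep, Move.apply]
    · funext j p
      simp only [step, hx, sweep, Function.update_apply]
      rcases lt_trichotomy p x.length with h | h | h
      · rw [if_neg h.ne, if_pos h, if_neg (by omega)]
      · subst h; simp [localImage, hd]
      · rw [if_neg h.ne', if_neg (by omega), if_pos (by omega), localImage, if_neg (by omega)]
        rfl
  | succ d ih =>
    rw [← Nat.add_assoc, run_succ, ih (by omega)]
    have hp : prevLetter x (x.length - 1 - d) = some x[x.length - 1 - d - 1] := by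
      rw [prevLetter, if_neg (by omega), List.getElem?_eq_getElem]
    ext1
    · simp only [step, sweep, lt_irrefl, if_false, hp]
      congr 4
      omega
    · simp only [step, sweep, Move.apply]; omega
    · simp only [step, sweep, Move.apply]; funext; omega
    · funext j p
      simp only [step, sweep, Function.update_apply]
      rcases lt_trichotomy p (x.length - 1 - d) with h | h | h
      · rw [if_neg h.ne, if_neg (by omega), if_neg (by omega)]
      · subst h
        have e : x.length - 1 - d + 1 = x.length - d := by omega
        have e' : x.length - 1 - (d + 1) < x.length - 1 - d := by omega
        have e'' : x.length - 1 - d ≤ x.length := by omega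
        simp only [lt_irrefl, if_false, if_true, localImage, e, e', e'']
      · rw [if_neg h.ne', if_pos h, if_pos (by omega)]

/-- The last evaluation happens at the leftmost cell, where the move to the left is absorbed by the
end of the tape; this is the one step beyond `2 * x.length`. -/
theorem sweep_run_end :
    (sweep M F j₀).run x (2 * x.length + 1) =
      { state := .inr (.inr (M.eval x))
        headIn := 0
        headOut := fun _ => 0
        tape := fun j p => (localImage (F j) x p).map .inl } := by
  rcases Nat.eq_zero_or_pos x.length with h0 | h0
  · obtain rfl := List.length_eq_zero_iff.1 h0
    rw [List.length_nil, Nat.mul_zero, run_succ, sweep_run_right M F j₀ [] 0 le_rfl]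
    ext1
    · simp [step, sweep, prevLetter]
    · simp [step, sweep, Move.apply]
    · simp [step, sweep, Move.apply]
    · funext j p
      by_cases hp : p = 0
      · subst hp; simp [step, sweep, localImage, prevLetter]
      · simp [step, sweep, localImage, hp]
  · have e : 2 * x.length + 1 = x.length + 1 + (x.length - 1) + 1 := by omega
    rw [e, run_succ, sweep_run_left M F j₀ x _ (by omega)]
    have e' : x.length - (x.length - 1) = 1 := by omega
    simp only [Nat.sub_self, e']
    ext1
    · simp [step, sweep, prevLetter]
    · simp [step, sweep, Move.apply]
    · simp [step, sweep, Move.apply]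
    · funext j p
      by_cases hp : p = 0
      · subst hp; simp [step, sweep, localImage, prevLetter]
      · simp [step, sweep, hp, Nat.pos_of_ne_zero hp]

theorem sweep_haltsAt : (sweep M F j₀).HaltsAt x (2 * x.length + 1) := by
  refine ⟨?_, fun i hi => ?_⟩
  · rw [sweep_run_end]
    exact ⟨_, rfl⟩
  · rcases le_or_gt i x.length with h | h
    · rw [sweep_run_right _ _ _ _ _ h]
      exact fun ⟨_, e⟩ => by cases e
    · obtain ⟨d, rfl⟩ := Nat.exists_eq_add_of_lt h
      rw [show x.length + d + 1 = x.length + 1 + d by omega,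
        sweep_run_left _ _ _ _ _ (by omega)]
      exact fun ⟨_, e⟩ => by cases e

theorem sweep_heads (i : ℕ) (hi : i ≤ 2 * x.length + 1) :
    ((sweep M F j₀).run x i).headIn = min i (2 * x.length - i) ∧
      ∀ j, ((sweep M F j₀).run x i).headOut j = min i (2 * x.length - i) := by
  rcases le_or_gt i x.length with h | h
  · rw [sweep_run_right _ _ _ _ _ h]
    dsimp only
    exact ⟨by omega, fun _ => by omega⟩
  rcases hi.eq_or_lt with rfl | h'
  · rw [sweep_run_end]
    dsimp only
    exact ⟨by omega, fun _ => by omega⟩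
  · obtain ⟨d, rfl⟩ := Nat.exists_eq_add_of_lt h
    rw [show x.length + d + 1 = x.length + 1 + d by omega, sweep_run_left _ _ _ _ _ (by omega)]
    dsimp only
    exact ⟨by omega, fun _ => by omega⟩

theorem mem_sweep_language : x ∈ (sweep M F j₀).language ↔ x ∈ M.accepts := by
  have h := sweep_haltsAt M F j₀ x
  have key : ((sweep M F j₀).run x (2 * x.length + 1)).state ∈ (sweep M F j₀).accepting ↔
      x ∈ M.accepts := by
    rw [sweep_run_end, DFA.mem_accepts]
    exact ⟨fun ⟨q, hq, e⟩ => by cases e; exact hq, fun hq => ⟨_, hq, rfl⟩⟩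
  constructor
  · rintro ⟨n, hn, ha⟩
    obtain rfl := hn.unique h
    exact key.1 ha
  · exact fun hx => ⟨_, h, key.2 hx⟩

variable {M F x} in
theorem sweep_translates (hx : x ∈ M.accepts) {y : Fin k → List A}
    (hy : ∀ j p, (y j)[p]? = localImage (F j) x p) : (sweep M F j₀).Translates x y := by
  refine ⟨_, sweep_haltsAt M F j₀ x, ?_, fun i p => ?_⟩
  · rw [sweep_run_end]
    exact ⟨_, (DFA.mem_accepts M).1 hx, rfl⟩
  · rw [sweep_run_end, hy]

theorem sweep_inClass
    (h : ∀ x ∈ M.accepts, ∃ y : Fin k → List A,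
      (∀ j p, (y j)[p]? = localImage (F j) x p) ∧ ∀ j, y j ∈ M.accepts) :
    (sweep M F j₀).InClass := by
  refine ⟨⟨0, fun x => ⟨0, le_rfl, 2 * x.length + 1, .inr rfl, sweep_haltsAt M F j₀ x,
    sweep_heads M F j₀ x⟩⟩, fun x hx => ?_⟩
  rw [mem_sweep_language] at hx
  obtain ⟨y, hy, hy'⟩ := h x hx
  exact ⟨y, sweep_translates j₀ hx hy, fun j => (mem_sweep_language M F j₀ _).2 (hy' j)⟩

end sweep

end TuringTransducer

/-! ### Lamps, position and the eight generators -/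

namespace Lamplighter

/-- The configuration of the lamps. -/
def lamp (g : Lamplighter) (x : ℤ) : ZMod 2 := (g.1.left (Multiplicative.ofAdd x)).toAdd

/-- The position of the lamplighter. -/
def pos (g : Lamplighter) : ℤ := g.1.right.toAdd

theorem ext_lamp {g g' : Lamplighter} (hp : pos g = pos g') (hl : ∀ x, lamp g x = lamp g' x) :
    g = g' := by
  refine Subtype.ext (RegularWreathProduct.ext (funext fun x => ?_) ?_)
  · exact Multiplicative.toAdd.injective (hl x.toAdd)
  · exact Multiplicative.toAdd.injective hp

@[simp] theorem pos_one : pos 1 = 0 := rfl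

@[simp] theorem lamp_one (x : ℤ) : lamp 1 x = 0 := rfl

@[simp] theorem pos_mul (g g' : Lamplighter) : pos (g * g') = pos g + pos g' := rfl

theorem lamp_mul (g g' : Lamplighter) (x : ℤ) :
    lamp (g * g') x = lamp g x + lamp g' (x - pos g) := by
  rw [sub_eq_neg_add]; rfl

theorem finite_support_lamp (g : Lamplighter) : (Function.support (lamp g)).Finite :=
  (Set.Finite.image Multiplicative.toAdd g.2).subset fun x hx =>
    ⟨Multiplicative.ofAdd x, hx, rfl⟩

/-- The element with given lamps and position. -/
def mk (f : ℤ → ZMod 2) (hf : (Function.support f).Finite) (b : ℤ) : Lamplighter :=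
  ⟨⟨fun x => Multiplicative.ofAdd (f x.toAdd), Multiplicative.ofAdd b⟩,
    (hf.image Multiplicative.ofAdd).subset fun x hx => ⟨x.toAdd, hx, rfl⟩⟩

@[simp] theorem pos_mk (f : ℤ → ZMod 2) (hf : (Function.support f).Finite) (b : ℤ) :
    pos (mk f hf b) = b := rfl

/-- The displacement `±1` of a generator. -/
def sgn (e : Bool) : ℤ := if e then 1 else -1

@[simp] theorem sgn_true : sgn true = 1 := rfl

@[simp] theorem sgn_false : sgn false = -1 := rfl

/-- The generator that changes the lamp at the present position by `α`, moves by `sgn e`, and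
changes the lamp at the new position by `β`. -/
def gen (e : Bool) (α β : ZMod 2) : Lamplighter :=
  mk (fun x => (if x = 0 then α else 0) + (if x = sgn e then β else 0))
    ((Set.toFinite {0, sgn e}).subset fun x hx => by
      by_contra h
      simp only [Set.mem_insert_iff, Set.mem_singleton_iff, not_or] at h
      simp [h.1, h.2] at hx) (sgn e)

@[simp] theorem pos_gen (e : Bool) (α β : ZMod 2) : pos (gen e α β) = sgn e := rfl

theorem lamp_gen (e : Bool) (α β : ZMod 2) (x : ℤ) :
    lamp (gen e α β) x = (if x = 0 then α else 0) + (if x = sgn e then β else 0) := rfl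

theorem lamp_mul_gen (g : Lamplighter) (e : Bool) (α β : ZMod 2) (x : ℤ) :
    lamp (g * gen e α β) x =
      lamp g x + (if x = pos g then α else 0) + (if x = pos g + sgn e then β else 0) := by
  rw [lamp_mul, lamp_gen, add_assoc]
  simp only [sub_eq_iff_eq_add, zero_add, add_comm (sgn e)]

theorem sgn_ne_zero (e : Bool) : sgn e ≠ 0 := by cases e <;> decide

/-- Each switching is its own inverse, and the step back meets the two lamps in the opposite order.
-/
theorem gen_inv (e : Bool) (α β : ZMod 2) : (gen e α β)⁻¹ = gen (!e) β α := by
  refine inv_eq_of_mul_eq_one_right (ext_lamp ?_ fun x => ?_)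
  · cases e <;> rfl
  · have hs : sgn e + sgn (!e) = 0 := by cases e <;> rfl
    rw [lamp_mul_gen, lamp_gen, pos_gen, hs, lamp_one]
    have h2 : ∀ a : ZMod 2, a + a = 0 := by decide
    by_cases hx : x = 0
    · subst hx; simp [h2, (sgn_ne_zero e).symm]
    · by_cases hx' : x = sgn e <;> simp [h2, hx, hx', sgn_ne_zero e]

theorem gen_injective {e e' : Bool} {α β α' β' : ZMod 2} (h : gen e α β = gen e' α' β') :
    e = e' ∧ α = α' ∧ β = β' := by
  have he : e = e' := by
    have := congrArg pos h
    revert this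
    cases e <;> cases e' <;> simp
  subst he
  have h0 := congrArg (lamp · 0) h
  have h1 := congrArg (lamp · (sgn e)) h
  simp only [lamp_gen, if_true, if_neg (sgn_ne_zero e), if_neg (sgn_ne_zero e).symm, zero_add,
    add_zero] at h0 h1
  exact ⟨rfl, h0, h1⟩

theorem lamp_t (x : ℤ) : lamp t x = 0 := rfl

theorem pos_t : pos t = 1 := rfl

theorem pos_h : pos h = 0 := rfl

theorem lamp_h (x : ℤ) : lamp h x = if x = 0 then 1 else 0 := by
  have : lamp h x = Multiplicative.toAdd (if Multiplicative.ofAdd x = 1 then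
      Multiplicative.ofAdd (1 : ZMod 2) else 1) := by
    simp only [lamp, h, Pi.mulSingle_apply]
  rw [this]
  simp only [ofAdd_eq_one]
  split_ifs <;> rfl

theorem t_eq : t = gen true 0 0 := ext_lamp rfl fun x => by
  rw [lamp_gen, lamp_t, ite_self, ite_self, add_zero]

theorem t_mul_h : t * h = gen true 0 1 := ext_lamp rfl fun x => by
  rw [lamp_gen, lamp_mul, lamp_t, lamp_h, pos_t, ite_self]
  by_cases hx : x = 1 <;> simp [hx, sub_eq_zero]

theorem h_mul_t : h * t = gen true 1 0 := ext_lamp rfl fun x => by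
  rw [lamp_gen, lamp_mul, lamp_t, lamp_h, ite_self]

theorem h_mul_t_mul_h : h * t * h = gen true 1 1 := ext_lamp rfl fun x => by
  rw [lamp_gen, lamp_mul, lamp_mul, lamp_t, lamp_h, lamp_h, pos_mul, pos_t, pos_h, add_zero]
  by_cases hx : x = 1 <;> simp [hx, sub_eq_zero]

theorem mem_Q₁ {s : Lamplighter} : s ∈ Q₁ ↔ ∃ α β, s = gen true α β := by
  classical
  rw [Q₁, h_mul_t_mul_h, h_mul_t, t_mul_h, t_eq]
  simp only [Finset.mem_insert, Finset.mem_singleton]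
  have h2 : ∀ a : ZMod 2, a = 0 ∨ a = 1 := by decide
  constructor
  · rintro (h | h | h | h) <;> exact ⟨_, _, h⟩
  · rintro ⟨α, β, rfl⟩
    rcases h2 α with rfl | rfl <;> rcases h2 β with rfl | rfl <;> simp

theorem mem_S₁ {s : Lamplighter} : s ∈ S₁ ↔ ∃ e α β, s = gen e α β := by
  classical
  rw [S₁, Finset.mem_union, Finset.mem_inv', mem_Q₁, mem_Q₁]
  constructor
  · rintro (⟨α, β, rfl⟩ | ⟨α, β, h⟩)
    · exact ⟨_, _, _, rfl⟩
    · exact ⟨_, _, _, by rw [← inv_inv s, h, gen_inv]⟩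
  · rintro ⟨e, α, β, rfl⟩
    cases e
    · exact .inr ⟨_, _, gen_inv _ _ _⟩
    · exact .inl ⟨_, _, rfl⟩

theorem gen_mem (e : Bool) (α β : ZMod 2) : gen e α β ∈ S₁ := mem_S₁.2 ⟨_, _, _, rfl⟩

theorem sum_S₁ (φ : Lamplighter → ℝ) :
    ∑ s ∈ S₁, φ s = ∑ α : ZMod 2, ∑ β : ZMod 2, (φ (gen true α β) + φ (gen false α β)) := by
  have : ∑ s ∈ S₁, φ s = ∑ p : Bool × ZMod 2 × ZMod 2, φ (gen p.1 p.2.1 p.2.2) := by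
    symm
    refine Finset.sum_bij (fun p _ => gen p.1 p.2.1 p.2.2) (fun p _ => gen_mem _ _ _)
      (fun p _ q _ h => ?_) (fun s hs => ?_) (fun _ _ => rfl)
    · obtain ⟨h1, h2, h3⟩ := gen_injective h
      exact Prod.ext h1 (Prod.ext h2 h3)
    · obtain ⟨e, α, β, rfl⟩ := mem_S₁.1 hs
      exact ⟨(e, α, β), Finset.mem_univ _, rfl⟩
  rw [this]
  simp only [Fintype.sum_prod_type, Fintype.sum_bool, Finset.sum_add_distrib]

theorem card_S₁ : S₁.card = 8 := by
  have := sum_S₁ fun _ => 1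
  simp only [Finset.sum_const, Finset.card_univ, ZMod.card, nsmul_eq_mul] at this
  norm_num at this
  exact_mod_cast this

/-! ### Word length -/

/-- The lamplighter and all lamps that are on lie in `[-M, M]`. -/
def Within (M : ℤ) (g : Lamplighter) : Prop := |pos g| ≤ M ∧ ∀ x, M < |x| → lamp g x = 0

/-- Only the new position can leave the old interval: the lamp underfoot already lies in it. -/
theorem Within.mul_gen {M : ℤ} {g : Lamplighter} (hg : Within M g) (e : Bool) (α β : ZMod 2) :
    Within (max M |pos g + sgn e|) (g * gen e α β) := by
  refine ⟨by simp, fun x hx => ?_⟩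
  obtain ⟨h1, h2⟩ := max_lt_iff.1 hx
  rw [lamp_mul_gen, hg.2 x h1, if_neg, if_neg, add_zero, add_zero]
  · rintro rfl; exact lt_irrefl _ h2
  · rintro rfl; exact absurd hg.1 (not_le.2 h1)

theorem within_one : Within 0 1 := ⟨by simp, fun _ _ => rfl⟩

theorem exists_within (g : Lamplighter) : ∃ M : ℤ, Within M g := by
  obtain ⟨B, hB⟩ := ((finite_support_lamp g).image fun x => |x|).bddAbove
  refine ⟨max |pos g| B, le_max_left _ _, fun x hx => ?_⟩
  by_contra h
  exact absurd (hB ⟨x, h, rfl⟩) (not_le.2 (max_lt_iff.1 hx).2)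

theorem pos_gen_pow (e : Bool) (n : ℕ) : pos (gen e 0 0 ^ n) = n * sgn e := by
  induction n with
  | zero => simp
  | succ n ih => rw [pow_succ, pos_mul, ih, pos_gen]; push_cast; ring

theorem lamp_gen_pow (e : Bool) (n : ℕ) (x : ℤ) : lamp (gen e 0 0 ^ n) x = 0 := by
  induction n with
  | zero => simp
  | succ n ih => rw [pow_succ, lamp_mul_gen, ih]; simp

/-- Each step to the right sets the lamp at which it arrives. -/
theorem exists_list_of_lamps (f : ℤ → ZMod 2) (n : ℕ) :
    ∃ l : List Lamplighter, l.length = n ∧ (∀ a ∈ l, a ∈ S₁) ∧ pos l.prod = n ∧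
      ∀ x, lamp l.prod x = if 1 ≤ x ∧ x ≤ n then f x else 0 := by
  induction n with
  | zero =>
    refine ⟨[], rfl, by simp, rfl, fun x => ?_⟩
    rw [if_neg (by omega)]; rfl
  | succ n ih =>
    obtain ⟨l, h1, h2, h3, h4⟩ := ih
    refine ⟨l ++ [gen true 0 (f (n + 1))], by simp [h1], ?_, by simp [h3], fun x => ?_⟩
    · intro a ha
      rcases List.mem_append.1 ha with ha | ha
      · exact h2 a ha
      · rw [List.mem_singleton.1 ha]; exact gen_mem _ _ _
    · rw [List.prod_append, List.prod_singleton, lamp_mul_gen, h3, h4, sgn_true]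
      push_cast
      rw [ite_self, add_zero]
      by_cases hx : x = n + 1
      · have h : 1 ≤ x ∧ x ≤ n + 1 := by omega
        have h' : ¬(1 ≤ x ∧ x ≤ n) := by omega
        rw [if_pos hx, if_pos h, if_neg h', hx, zero_add]
      · rw [if_neg hx, add_zero]
        have h : (1 ≤ x ∧ x ≤ n) ↔ (1 ≤ x ∧ x ≤ n + 1) := by omega
        simp only [h]

/-- Walk left to `-(M + 1)`, then right to `M` while setting the `2 * M + 1` lamps of `[-M, M]`,
then back to the final position, which takes at most `2 * M` steps. The total is at most `(M + 1) +
(2 * M + 1) + 2 * M`. -/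
theorem Within.exists_list {M : ℤ} {g : Lamplighter} (hg : Within M g) :
    ∃ l : List Lamplighter, (l.length : ℤ) ≤ 5 * M + 2 ∧ (∀ a ∈ l, a ∈ S₁) ∧ l.prod = g := by
  obtain ⟨hb, hl⟩ := hg
  obtain ⟨hb1, hb2⟩ := abs_le.1 hb
  lift M to ℕ using (abs_nonneg _).trans hb
  obtain ⟨m, hm⟩ := Int.eq_ofNat_of_zero_le (sub_nonneg.2 hb2)
  obtain ⟨l, h1, h2, h3, h4⟩ := exists_list_of_lamps (fun x => lamp g (x - (M + 1))) (2 * M + 1)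
  refine ⟨List.replicate (M + 1) (gen false 0 0) ++ l ++ List.replicate m (gen false 0 0),
    ?_, ?_, ?_⟩
  · simp only [List.length_append, List.length_replicate, h1]
    push_cast
    omega
  · intro a ha
    simp only [List.mem_append, List.mem_replicate] at ha
    rcases ha with (ha | ha) | ha
    · rw [ha.2]; exact gen_mem _ _ _
    · exact h2 a ha
    · rw [ha.2]; exact gen_mem _ _ _
  · simp only [List.prod_append, List.prod_replicate]
    refine ext_lamp ?_ fun x => ?_
    · simp only [pos_mul, pos_gen_pow, h3, sgn_false]
      push_cast
      omega
    · rw [lamp_mul, lamp_mul, lamp_gen_pow, lamp_gen_pow, h4, pos_gen_pow, sgn_false]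
      push_cast
      by_cases hx : |x| ≤ M
      · have := abs_le.1 hx
        rw [if_pos (by omega), zero_add, add_zero]
        congr 1; ring
      · rw [hl x (not_le.1 hx), if_neg, zero_add, add_zero]
        rw [abs_le] at hx
        omega

theorem Within.wordLength_le {M : ℤ} {g : Lamplighter} (hg : Within M g) :
    (wordLength S₁ g : ℤ) ≤ 5 * M + 2 := by
  obtain ⟨l, h1, h2, h3⟩ := hg.exists_list
  have h : wordLength S₁ g ≤ l.length := Nat.sInf_le ⟨l, rfl, h2, h3⟩
  exact (Int.ofNat_le.2 h).trans h1

theorem exists_list_prod (g : Lamplighter) :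
    ∃ l : List Lamplighter, (∀ a ∈ l, a ∈ S₁) ∧ l.prod = g :=
  let ⟨_, hM⟩ := exists_within g
  let ⟨l, _, h2, h3⟩ := hM.exists_list
  ⟨l, h2, h3⟩

theorem closure_S₁ : Subgroup.closure (S₁ : Set Lamplighter) = ⊤ := by
  refine eq_top_iff.2 fun g _ => ?_
  obtain ⟨l, hl, rfl⟩ := exists_list_prod g
  exact Subgroup.list_prod_mem _ fun a ha => Subgroup.subset_closure (hl a ha)

theorem abs_pos_prod_le (l : List Lamplighter) (hl : ∀ a ∈ l, a ∈ S₁) :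
    |pos l.prod| ≤ l.length := by
  induction l with
  | nil => simp
  | cons a l ih =>
    obtain ⟨e, α, β, h⟩ := mem_S₁.1 (hl a (by simp))
    have h1 : |pos a| = 1 := by rw [h, pos_gen]; cases e <;> rfl
    have := ih fun b hb => hl b (by simp [hb])
    rw [List.prod_cons, pos_mul, List.length_cons]
    push_cast
    linarith [abs_add_le (pos a) (pos l.prod)]

theorem abs_pos_le_wordLength (g : Lamplighter) : |pos g| ≤ wordLength S₁ g := by
  obtain ⟨l, h1, h2⟩ := exists_list_prod g
  have hne : {n | ∃ l : List Lamplighter, l.length = n ∧ (∀ a ∈ l, a ∈ S₁) ∧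
      l.prod = g}.Nonempty := ⟨_, l, rfl, h1, h2⟩
  obtain ⟨l', h1', h2', h3'⟩ := Nat.sInf_mem hne
  have := abs_pos_prod_le l' h2'
  rw [h3', h1'] at this
  exact this

end Lamplighter

/-! ### The Markov operator and the drift -/

section RandomWalk

variable {G : Type*} [Group G]

/-- The Markov operator of the simple random walk. -/
noncomputable def markov (S : Finset G) (φ : G → ℝ) (g : G) : ℝ :=
  (1 / (S.card : ℝ)) * ∑ s ∈ S, φ (g * s)

theorem markov_iterate_eq_sum (S : Finset G) (n : ℕ) (φ : G → ℝ) (g : G) :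
    (markov S)^[n] φ g =
      (1 / (S.card : ℝ)) ^ n * ∑ w : Fin n → S, φ (g * (List.ofFn fun i => (w i : G)).prod) := by
  induction n generalizing g with
  | zero => simp
  | succ n ih =>
    rw [Function.iterate_succ_apply', markov, ← Finset.sum_coe_sort S, pow_succ', mul_assoc,
      Finset.mul_sum (s := Finset.univ (α := Fin (n + 1) → S)),
      ← (Fin.consEquiv fun _ : Fin (n + 1) => S).sum_comp, Fintype.sum_prod_type]
    simp only [ih, Finset.mul_sum, Fin.consEquiv, Equiv.coe_fn_mk, List.ofFn_succ, Fin.cons_zero,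
      Fin.cons_succ, List.prod_cons, mul_assoc]

open Classical in
theorem convPow_eq (S : Finset G) (n : ℕ) (g : G) :
    convPow S n g = ∑ w : Fin n → S with (List.ofFn fun i => (w i : G)).prod = g,
      (1 / (S.card : ℝ)) ^ n := by
  simp [convPow, stepMeasure]

/-- Products of `n` generators lie in the ball of radius `n`, so the restriction to the ball loses
nothing; the sum over words is then grouped by the value of the product. -/
theorem drift_eq_markov (S : Finset G) (n : ℕ) :
    drift S n = (markov S)^[n] (fun g => (wordLength S g : ℝ)) 1 := by
  classical
  have hball (w : Fin n → S) : (List.ofFn fun i => (w i : G)).prod ∈ wordBall S n := by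
    refine Nat.sInf_le ⟨List.ofFn fun i => (w i : G), by simp, fun a ha => ?_, rfl⟩
    obtain ⟨i, rfl⟩ := List.mem_ofFn.1 ha
    exact (w i).2
  let p : (Fin n → S) → G := fun w => (List.ofFn fun i => (w i : G)).prod
  have h : drift S n = ∑ g ∈ Finset.univ.image p, (wordLength S g : ℝ) * convPow S n g := by
    refine finsum_mem_eq_sum_of_inter_support_eq _ (Set.ext fun g => ⟨fun hg => ?_, fun hg => ?_⟩)
    · refine ⟨?_, hg.2⟩
      have hc : convPow S n g ≠ 0 := right_ne_zero_of_mul hg.2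
      rw [convPow_eq] at hc
      obtain ⟨w, hw, -⟩ := Finset.exists_ne_zero_of_sum_ne_zero hc
      exact Finset.mem_coe.2 (Finset.mem_image.2 ⟨w, Finset.mem_univ _, (Finset.mem_filter.1 hw).2⟩)
    · refine ⟨?_, hg.2⟩
      obtain ⟨w, -, rfl⟩ := Finset.mem_image.1 (Finset.mem_coe.1 hg.1)
      exact hball w
  rw [h, markov_iterate_eq_sum, Finset.mul_sum]
  simp only [one_mul]
  rw [← Finset.sum_fiberwise_of_maps_to (g := p) (t := Finset.univ.image p)
    (fun w hw => Finset.mem_image_of_mem _ hw)]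
  refine Finset.sum_congr rfl fun g _ => ?_
  rw [convPow_eq, Finset.mul_sum]
  refine Finset.sum_congr rfl fun w hw => ?_
  have : p w = g := (Finset.mem_filter.1 hw).2
  rw [mul_comm, ← this]

end RandomWalk

namespace Lamplighter

theorem markov_S₁ (φ : Lamplighter → ℝ) (g : Lamplighter) :
    markov S₁ φ g = (1 / 8) * ∑ α : ZMod 2, ∑ β : ZMod 2,
      (φ (g * gen true α β) + φ (g * gen false α β)) := by
  rw [markov, sum_S₁ fun s => φ (g * s), card_S₁]
  norm_num

/-- If the bound depends only on the direction, the lamps average out and one step of simple random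
walk on `ℤ` remains. -/
theorem le_markov {φ : Lamplighter → ℝ} {g : Lamplighter} (r : Bool → ℝ)
    (h : ∀ e α β, r e ≤ φ (g * gen e α β)) : (r true + r false) / 2 ≤ markov S₁ φ g := by
  have : ∑ _α : ZMod 2, ∑ _β : ZMod 2, (r true + r false) ≤ ∑ α : ZMod 2, ∑ β : ZMod 2,
      (φ (g * gen true α β) + φ (g * gen false α β)) :=
    Finset.sum_le_sum fun α _ => Finset.sum_le_sum fun β _ => add_le_add (h _ _ _) (h _ _ _)
  rw [markov_S₁]
  simp only [Finset.sum_const, Finset.card_univ, ZMod.card, nsmul_eq_mul] at this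
  norm_num at this
  linarith

theorem markov_le {φ : Lamplighter → ℝ} {g : Lamplighter} (r : Bool → ℝ)
    (h : ∀ e α β, φ (g * gen e α β) ≤ r e) : markov S₁ φ g ≤ (r true + r false) / 2 := by
  have : ∑ α : ZMod 2, ∑ β : ZMod 2, (φ (g * gen true α β) + φ (g * gen false α β)) ≤
      ∑ _α : ZMod 2, ∑ _β : ZMod 2, (r true + r false) :=
    Finset.sum_le_sum fun α _ => Finset.sum_le_sum fun β _ => add_le_add (h _ _ _) (h _ _ _)
  rw [markov_S₁]
  simp only [Finset.sum_const, Finset.card_univ, ZMod.card, nsmul_eq_mul] at this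
  norm_num at this
  linarith

/-! ### The lower bound, by the second and the fourth moment -/

/-- The inequality `|x| ≥ (3 x² / a - x⁴ / a³) / 2` reduces the first absolute moment to the second
and the fourth. For simple random walk from `x` these are `x² + n` and `x⁴ + 6 n x² + 3 n² - 2 n`;
dropping `-2 n` only weakens the bound. -/
theorem le_markov_iterate {φ : Lamplighter → ℝ} {b₀ : ℤ} (hφ : ∀ g, |(pos g : ℝ) - b₀| ≤ φ g)
    {a : ℝ} (ha : 0 < a) (n : ℕ) (g : Lamplighter) :
    (3 * (((pos g : ℝ) - b₀) ^ 2 + n) / a -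
      (((pos g : ℝ) - b₀) ^ 4 + 6 * n * ((pos g : ℝ) - b₀) ^ 2 + 3 * n ^ 2) / a ^ 3) / 2 ≤
      (markov S₁)^[n] φ g := by
  induction n generalizing g with
  | zero =>
    refine le_trans ?_ (hφ g)
    generalize (pos g : ℝ) - b₀ = x
    rw [← sq_abs x, ← Even.pow_abs (by decide : Even 4) x]
    have hy := abs_nonneg x
    generalize |x| = y at *
    -- The difference has a double zero at `y = a`, where the two sides touch.
    have h : y - (3 * y ^ 2 / a - y ^ 4 / a ^ 3) / 2 =
        y * (a - y) ^ 2 * (2 * a + y) / (2 * a ^ 3) := by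
      field_simp
      ring
    have h' : 0 ≤ y * (a - y) ^ 2 * (2 * a + y) / (2 * a ^ 3) := by positivity
    norm_num
    linarith
  | succ n ih =>
    rw [Function.iterate_succ_apply']
    refine le_trans ?_ (le_markov _ fun e α β => ih (g * gen e α β) |> le_trans (le_of_eq
      (show (3 * (((pos g : ℝ) - b₀ + sgn e) ^ 2 + n) / a -
        (((pos g : ℝ) - b₀ + sgn e) ^ 4 + 6 * n * ((pos g : ℝ) - b₀ + sgn e) ^ 2 + 3 * n ^ 2) /
          a ^ 3) / 2 = _ by
        rw [pos_mul, pos_gen]; push_cast; ring)))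
    generalize (pos g : ℝ) - b₀ = x
    rw [← sub_nonneg]
    -- This is the slack gained in each step by replacing `3 n² - 2 n` by `3 n²`.
    have h' : 0 ≤ 1 / a ^ 3 := by positivity
    refine h'.trans_eq ?_
    rw [sgn_true, sgn_false]
    push_cast
    field_simp
    ring

theorem le_markov_iterate_sqrt {φ : Lamplighter → ℝ} {b₀ : ℤ}
    (hφ : ∀ g, |(pos g : ℝ) - b₀| ≤ φ g) {g : Lamplighter} (hg : pos g = b₀) (n : ℕ)
    (hn : 1 ≤ n) : 9 / 16 * Real.sqrt n ≤ (markov S₁)^[n] φ g := by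
  have hn' : (0 : ℝ) < n := by exact_mod_cast hn
  have hs : 0 < Real.sqrt n := Real.sqrt_pos.2 hn'
  -- With `a = 2 √n` and `x = 0` the bound is `(3 / 2 - 3 / 8) / 2 = 9 / 16` times `√n`.
  refine le_trans (le_of_eq ?_)
    (le_markov_iterate hφ (a := 2 * Real.sqrt n) (by positivity) n g)
  rw [hg]
  have h2 : (n : ℝ) = Real.sqrt n ^ 2 := (Real.sq_sqrt hn'.le).symm
  generalize Real.sqrt n = r at *
  rw [h2]
  field_simp
  ring

/-! ### The upper bound, by a maximal inequality -/

/-- A quadratic form whose mean grows by at most `4` with each step of the walk, if `M` is the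
maximal distance from the origin so far. -/
def maximalForm (b M : ℤ) : ℤ := 2 * M ^ 2 - 4 * |b| * M + 4 * b ^ 2

theorem sq_le_maximalForm (b M : ℤ) : M ^ 2 ≤ maximalForm b M := by
  rw [maximalForm, ← sq_abs b]
  nlinarith [sq_nonneg (M - 2 * |b|)]

/-- Below the record, `M` stays fixed, `b²` grows by `1` in the mean, and the mean of `|b|` does not
decrease, so the form gains at most `4`. At the record only the outward step raises `M`, and the two
values are computed directly. -/
theorem maximalForm_step {b M : ℤ} (h : |b| ≤ M) :
    maximalForm (b + 1) (max M |b + 1|) + maximalForm (b - 1) (max M |b - 1|) ≤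
      2 * (maximalForm b M + 4) := by
  unfold maximalForm
  rcases h.lt_or_eq with h | rfl
  · have h1 : |b + 1| ≤ M := (abs_add_le b 1).trans (by simpa using h)
    have h2 : |b - 1| ≤ M := (abs_sub b 1).trans (by simpa using h)
    rw [max_eq_left h1, max_eq_left h2]
    have h3 : 2 * |b| ≤ |b + 1| + |b - 1| := by
      have := abs_add_le (b + 1) (b - 1)
      rw [show b + 1 + (b - 1) = 2 * b by ring, abs_mul] at this
      exact this
    have h4 : 0 ≤ M := (abs_nonneg b).trans h.le
    nlinarith [mul_le_mul_of_nonneg_left h3 h4]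
  · rcases lt_trichotomy b 0 with hb | rfl | hb
    · rw [abs_of_neg hb, abs_of_neg (by omega : b - 1 < 0),
        abs_of_nonpos (by omega : b + 1 ≤ 0), max_eq_left (by omega), max_eq_right (by omega)]
      nlinarith
    · norm_num
    · rw [abs_of_pos hb, abs_of_pos (by omega : 0 < b + 1),
        abs_of_nonneg (by omega : 0 ≤ b - 1), max_eq_right (by omega), max_eq_left (by omega)]
      nlinarith

/-- The radius `M` is not a function of `g`; admitting every `M` with `Within M g` lets the
induction carry it along as a running maximum. At time zero `M ≤ (M² / a + a) / 2`, and `M²` is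
bounded by the form, whose mean grows by at most `4` per step. -/
theorem markov_iterate_le {φ : Lamplighter → ℝ} {K : ℝ} (hK : 0 ≤ K)
    (hφ : ∀ g M, Within M g → φ g ≤ K * (1 + M)) {a : ℝ} (ha : 0 < a) (n : ℕ)
    {g : Lamplighter} {M : ℤ} (hg : Within M g) :
    (markov S₁)^[n] φ g ≤ K * (1 + ((maximalForm (pos g) M + 4 * n) / a + a) / 2) := by
  induction n generalizing g M with
  | zero =>
    refine (hφ g M hg).trans (mul_le_mul_of_nonneg_left ?_ hK)
    have h1 : (M : ℝ) ^ 2 ≤ maximalForm (pos g) M := by exact_mod_cast sq_le_maximalForm _ _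
    have h2 : (M : ℝ) ≤ (M ^ 2 / a + a) / 2 := by
      rw [← sub_nonneg, show ((M : ℝ) ^ 2 / a + a) / 2 - M = (M - a) ^ 2 / (2 * a) by
        field_simp; ring]
      positivity
    have h3 : (M : ℝ) ^ 2 / a ≤ maximalForm (pos g) M / a := by gcongr
    rw [Nat.cast_zero, mul_zero, add_zero]
    linarith
  | succ n ih =>
    rw [Function.iterate_succ_apply']
    refine (markov_le (fun e => K * (1 + ((maximalForm (pos g + sgn e)
      (max M |pos g + sgn e|) + 4 * n) / a + a) / 2)) fun e α β => ih (hg.mul_gen e α β)).trans ?_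
    simp only [sgn_true, sgn_false]
    have h : ((maximalForm (pos g + 1) (max M |pos g + 1|) : ℤ) : ℝ) +
        (maximalForm (pos g + -1) (max M |pos g + -1|) : ℤ) ≤ 2 * (maximalForm (pos g) M + 4) := by
      exact_mod_cast maximalForm_step hg.1
    rw [← mul_add, mul_div_assoc]
    refine mul_le_mul_of_nonneg_left ?_ hK
    have h' := div_le_div_of_nonneg_right h ha.le
    push_cast
    simp only [div_eq_mul_inv] at h' ⊢
    linarith

theorem markov_iterate_le_sqrt {φ : Lamplighter → ℝ} {K : ℝ} (hK : 0 ≤ K)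
    (hφ : ∀ g M, Within M g → φ g ≤ K * (1 + M)) {g : Lamplighter} {M : ℤ} (hg : Within M g)
    (n : ℕ) (hn : 1 ≤ n) :
    (markov S₁)^[n] φ g ≤ K * (maximalForm (pos g) M + 4) * Real.sqrt n := by
  have hn' : (1 : ℝ) ≤ n := by exact_mod_cast hn
  have hs : 1 ≤ Real.sqrt n := Real.one_le_sqrt.2 hn'
  refine (markov_iterate_le hK hφ (a := Real.sqrt n) (by linarith) n hg).trans ?_
  rw [mul_assoc]
  refine mul_le_mul_of_nonneg_left ?_ hK
  have hQ : (0 : ℝ) ≤ maximalForm (pos g) M := by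
    exact_mod_cast (sq_nonneg M).trans (sq_le_maximalForm _ _)
  have h2 : (n : ℝ) = Real.sqrt n ^ 2 := (Real.sq_sqrt (by linarith)).symm
  generalize Real.sqrt n = r at *
  generalize ((maximalForm (pos g) M : ℤ) : ℝ) = q at *
  have h3 : q / r ≤ q * r := (div_le_self hQ hs).trans (le_mul_of_one_le_right hQ hs)
  have h4 : 4 * r ^ 2 / r = 4 * r := by field_simp
  rw [h2, add_div, add_div, h4]
  nlinarith [mul_nonneg hQ (by linarith : 0 ≤ r)]

theorem asymp_drift : Asymp (drift S₁) fun n => Real.sqrt n := by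
  have hlow (n : ℕ) (hn : 1 ≤ n) : 9 / 16 * Real.sqrt n ≤ drift S₁ n := by
    rw [drift_eq_markov]
    refine le_markov_iterate_sqrt (b₀ := 0) (fun g => ?_) rfl n hn
    rw [Int.cast_zero, sub_zero]
    exact_mod_cast abs_pos_le_wordLength g
  -- Word length is at most `5 * M + 2 ≤ 5 * (1 + M)`, and the form vanishes at the identity, whence
  -- `5 * (0 + 4)`.
  have hup (n : ℕ) (hn : 1 ≤ n) : drift S₁ n ≤ 20 * Real.sqrt n := by
    rw [drift_eq_markov]
    refine (markov_iterate_le_sqrt (K := 5) (by norm_num) (fun g M hg => ?_) within_one n hn).trans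
      (le_of_eq ?_)
    · have h : ((wordLength S₁ g : ℤ) : ℝ) ≤ (5 * M + 2 : ℤ) := by exact_mod_cast hg.wordLength_le
      push_cast at h
      linarith
    · norm_num [maximalForm]
  exact ⟨9 / 16, 20, by norm_num, by norm_num, fun n hn => ⟨hlow n hn, hup n hn⟩⟩

end Lamplighter

namespace Lamplighter

/-! ### Encoding by words: the integers are folded into the two sides of the cells -/

/-- A cell describes two integers, one on each side; for each of them, whether the lamp is on and
whether the lamplighter is there. -/
abbrev Cell : Type := Bool → ZMod 2 × Bool

/-- The cell without lamps and without the lamplighter. -/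
def blank : Cell := fun _ => (0, false)

/-- The integer on the side `d` of the cell `i`. -/
def site (d : Bool) (i : ℕ) : ℤ := if d then i else -i - 1

theorem site_inj {d d' : Bool} {i i' : ℕ} : site d i = site d' i' ↔ d = d' ∧ i = i' := by
  cases d <;> cases d' <;> simp [site] <;> omega

theorem exists_site (z : ℤ) : ∃ d i, z = site d i := by
  rcases le_or_gt 0 z with h | h
  · exact ⟨true, z.toNat, by simp [site, h]⟩
  · exact ⟨false, (-z - 1).toNat, by simp [site]; omega⟩

theorem le_abs_site (d : Bool) (i : ℕ) : (i : ℤ) ≤ |site d i| := by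
  cases d
  · rw [site, if_neg (by decide), abs_of_neg (by omega)]; omega
  · simp [site]

theorem abs_site_le (d : Bool) (i : ℕ) : |site d i| ≤ i + 1 := by
  cases d
  · rw [site, if_neg (by decide), abs_of_neg (by omega)]; omega
  · simp [site]

/-- The cells of an element. -/
def cell (g : Lamplighter) (i : ℕ) : Cell :=
  fun d => (lamp g (site d i), decide (pos g = site d i))

theorem cell_injective : Function.Injective cell := by
  intro g g' h
  have h' (d i) := congrFun (congrFun h i) d
  refine ext_lamp ?_ fun z => ?_
  · obtain ⟨d, i, hz⟩ := exists_site (pos g)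
    have := congrArg Prod.snd (h' d i)
    simp only [cell, decide_eq_decide] at this
    rw [this.1 hz, hz]
  · obtain ⟨d, i, rfl⟩ := exists_site z
    exact congrArg Prod.fst (h' d i)

theorem Within.cell_eq_blank {M : ℤ} {g : Lamplighter} (hg : Within M g) {i : ℕ} (hi : M < i) :
    cell g i = blank := by
  funext d
  have h : M < |site d i| := hi.trans_le (le_abs_site d i)
  refine Prod.ext (hg.2 _ h) (decide_eq_false fun h' => ?_)
  rw [← h'] at h
  exact absurd hg.1 (not_le.2 h)

/-- The length of the encoding. -/
noncomputable def len (g : Lamplighter) : ℕ := sInf {N | ∀ i ≥ N, cell g i = blank}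

theorem len_le {g : Lamplighter} {N : ℕ} (h : ∀ i ≥ N, cell g i = blank) : len g ≤ N :=
  Nat.sInf_le h

theorem cell_of_len_le {g : Lamplighter} {i : ℕ} (h : len g ≤ i) : cell g i = blank := by
  obtain ⟨M, hM⟩ := exists_within g
  have hne : {N | ∀ i ≥ N, cell g i = blank}.Nonempty :=
    ⟨(M + 1).toNat, fun i hi => hM.cell_eq_blank (by have : (M + 1).toNat ≤ i := hi; omega)⟩
  exact Nat.sInf_mem hne i h

theorem Within.len_le {M : ℤ} {g : Lamplighter} (hg : Within M g) : (len g : ℤ) ≤ M + 1 := by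
  have h0 : 0 ≤ M := (abs_nonneg _).trans hg.1
  have : len g ≤ (M + 1).toNat := Lamplighter.len_le fun i hi =>
    hg.cell_eq_blank (by have : (M + 1).toNat ≤ i := hi; omega)
  omega

theorem lt_len_of_pos {g : Lamplighter} {d : Bool} {i : ℕ} (h : pos g = site d i) :
    i < len g := by
  by_contra hi
  have := congrArg Prod.snd (congrFun (cell_of_len_le (not_lt.1 hi)) d)
  simp [cell, blank, h] at this

theorem abs_pos_le_len (g : Lamplighter) : |pos g| ≤ len g := by
  obtain ⟨d, i, h⟩ := exists_site (pos g)
  have := lt_len_of_pos h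
  have := abs_site_le d i
  rw [h]
  omega

theorem one_le_len (g : Lamplighter) : 1 ≤ len g := by
  obtain ⟨d, i, h⟩ := exists_site (pos g)
  have := lt_len_of_pos h
  omega

/-- The word that encodes an element. -/
noncomputable def encode (g : Lamplighter) : List Cell := (List.range (len g)).map (cell g)

@[simp] theorem length_encode (g : Lamplighter) : (encode g).length = len g := by simp [encode]

theorem encode_getElem? (g : Lamplighter) (i : ℕ) :
    (encode g)[i]? = if i < len g then some (cell g i) else none := by
  rw [encode, List.getElem?_map]
  split_ifs with h
  · rw [List.getElem?_range h]; rfl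
  · rw [List.getElem?_eq_none (by simpa using h)]; rfl

theorem encode_getD (g : Lamplighter) (i : ℕ) : (encode g)[i]?.getD blank = cell g i := by
  rw [encode_getElem?]
  split_ifs with h
  · rfl
  · exact (cell_of_len_le (not_lt.1 h)).symm

theorem encode_injective : Function.Injective encode := fun g g' h =>
  cell_injective (funext fun i => by rw [← encode_getD, h, encode_getD])

/-! ### Right multiplication by a generator is local -/

/-- The new cell from the preceding, the present and the next cell. -/
def rule (e : Bool) (α β : ZMod 2) (u : Option Cell) (v w : Cell) : Cell := fun d =>
  -- On the side `d = e` the step leads outward, so the lamplighter comes from the preceding cell,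
  -- or at the fold from the other side of cell `0`; on the opposite side it comes from the next
  -- cell.
  let c : Bool := if d = e then (match u with | none => (v !d).2 | some u => (u d).2) else (w d).2
  ((v d).1 + (if (v d).2 then α else 0) + (if c then β else 0), c)

theorem cell_mul_gen (g : Lamplighter) (e : Bool) (α β : ZMod 2) (i : ℕ) :
    cell (g * gen e α β) i =
      rule e α β (if i = 0 then none else some (cell g (i - 1))) (cell g i) (cell g (i + 1)) := by
  funext d
  have hc : decide (pos g + sgn e = site d i) = if d = e then
      (match (if i = 0 then none else some (cell g (i - 1))) with
        | none => (cell g i !d).2 | some u => (u d).2) else (cell g (i + 1) d).2 := by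
    by_cases hd : d = e
    · subst hd
      rw [if_pos rfl]
      rcases i with _ | i
      · rw [if_pos rfl]
        simp only [cell, decide_eq_decide]
        cases d <;> simp [site]
        omega
      · rw [if_neg (Nat.succ_ne_zero i)]
        simp only [cell, decide_eq_decide]
        cases d <;> simp [site]
        omega
    · rw [if_neg hd]
      simp only [cell, decide_eq_decide]
      cases d <;> cases e <;> simp [site] at hd ⊢ <;> omega
  refine Prod.ext ?_ hc
  simp only [rule, ← hc]
  simp only [cell, lamp_mul_gen, decide_eq_true_eq]
  simp only [eq_comm]

theorem rule_blank (e : Bool) (α β : ZMod 2) : rule e α β (some blank) blank blank = blank := by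
  funext d
  simp [rule, blank]

theorem len_mul_gen_le (g : Lamplighter) (e : Bool) (α β : ZMod 2) :
    len (g * gen e α β) ≤ len g + 1 := by
  refine len_le fun i hi => ?_
  rw [cell_mul_gen, if_neg (by omega), cell_of_len_le (by omega : len g ≤ i - 1),
    cell_of_len_le (by omega : len g ≤ i), cell_of_len_le (by omega : len g ≤ i + 1), rule_blank]

/-- The inverse step is again a generator, so it lengthens the word by at most one. -/
theorem len_le_len_mul_gen (g : Lamplighter) (e : Bool) (α β : ZMod 2) :
    len g ≤ len (g * gen e α β) + 1 := by
  have := len_mul_gen_le (g * gen e α β) (!e) β α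
  rwa [← gen_inv, mul_inv_cancel_right] at this

/-- The local map of a generator. -/
def localRule (e : Bool) (α β : ZMod 2) (u v w : Option Cell) : Option Cell :=
  -- A blank new cell ends the word only if nothing follows it. The lamplighter may step out of the
  -- last cell and leave it blank, so the new cell one place further must be tested as well.
  if w = none ∧ rule e α β u (v.getD blank) blank = blank ∧
    rule e α β (some (v.getD blank)) blank blank = blank then none
  else some (rule e α β u (v.getD blank) (w.getD blank))

theorem localImage_encode (g : Lamplighter) (e : Bool) (α β : ZMod 2) (p : ℕ) :
    TuringTransducer.localImage (localRule e α β) (encode g) p =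
      (encode (g * gen e α β))[p]? := by
  rw [TuringTransducer.localImage, length_encode]
  have h1 := len_mul_gen_le g e α β
  have h2 := len_le_len_mul_gen g e α β
  split_ifs with hp
  · have hu : TuringTransducer.prevLetter (encode g) p =
        if p = 0 then none else some (cell g (p - 1)) := by
      rw [TuringTransducer.prevLetter]
      split_ifs
      · rfl
      · rw [encode_getElem?, if_pos (by omega)]
    rw [localRule, encode_getD, encode_getD, hu, ← cell_mul_gen, encode_getElem?, encode_getElem?]
    by_cases hw : len g ≤ p + 1
    · have e1 : cell g (p + 1) = blank := cell_of_len_le hw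
      have e2 : cell g (p + 2) = blank := cell_of_len_le (by omega)
      have hc : cell (g * gen e α β) p = rule e α β
          (if p = 0 then none else some (cell g (p - 1))) (cell g p) blank := by
        rw [cell_mul_gen, e1]
      have hc' : cell (g * gen e α β) (p + 1) =
          rule e α β (some (cell g p)) blank blank := by
        rw [cell_mul_gen, e1, e2, if_neg (Nat.succ_ne_zero p), Nat.add_sub_cancel]
      rw [if_neg (not_lt.2 hw), ← hc, ← hc']
      by_cases h : len (g * gen e α β) ≤ p
      · rw [if_neg (not_lt.2 h), if_pos ⟨rfl, cell_of_len_le h, cell_of_len_le (by omega)⟩]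
      · rw [if_pos (not_le.1 h), if_neg]
        rintro ⟨-, h3, h4⟩
        refine h (len_le fun i hi => ?_)
        obtain rfl | rfl | hi : i = p ∨ i = p + 1 ∨ p + 2 ≤ i := by
          have : p ≤ i := hi
          omega
        · exact h3
        · exact h4
        · exact cell_of_len_le (by omega)
    -- At least two cells before the old end the word cannot stop, since it shrinks by at most one.
    · rw [if_pos (not_le.1 hw), if_neg (by simp), if_pos (by omega)]
  · rw [encode_getElem?, if_neg (by omega)]

/-! ### The language of the encodings is regular -/

/-- The automaton that accepts the encodings. It remembers whether it has seen the lamplighter and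
whether the last letter is not blank. -/
def automaton : DFA Cell (Option (Bool × Bool)) where
  start := some (false, false)
  accept := {some (true, true)}
  step q a := match q, (a true).2, (a false).2 with
    | some (s, _), false, false => some (s, decide (a ≠ blank))
    | some (false, _), true, false => some (true, decide (a ≠ blank))
    | some (false, _), false, true => some (true, decide (a ≠ blank))
    | _, _, _ => none

theorem eval_map_cell (g : Lamplighter) {c : Bool} {j : ℕ} (h : pos g = site c j) (N : ℕ) :
    automaton.eval ((List.range N).map (cell g)) =
      some (decide (j < N), decide (0 < N ∧ cell g (N - 1) ≠ blank)) := by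
  induction N with
  | zero => simp [automaton]
  | succ N ih =>
    rw [List.range_succ, List.map_append, List.map_singleton, DFA.eval_append_singleton, ih]
    have hd (d : Bool) : (cell g N d).2 = decide (c = d ∧ j = N) := by
      simp only [cell, h, site_inj]
    simp only [automaton, hd, Nat.add_sub_cancel, Nat.succ_pos, true_and]
    rcases lt_trichotomy j N with h | h | h
    · simp [h.ne, h, h.trans (Nat.lt_succ_self N)]
    · subst h; cases c <;> simp
    · simp [h.ne', h.not_gt, h]

theorem encode_mem_accepts (g : Lamplighter) : encode g ∈ automaton.accepts := by
  obtain ⟨c, j, h⟩ := exists_site (pos g)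
  have h1 := one_le_len g
  have h2 : cell g (len g - 1) ≠ blank := fun h => by
    have : len g ≤ len g - 1 := len_le fun i hi => by
      rcases (show len g - 1 ≤ i from hi).eq_or_lt with rfl | hi
      · exact h
      · exact cell_of_len_le (by omega)
    omega
  rw [DFA.mem_accepts, encode, eval_map_cell g h]
  simp [automaton, lt_len_of_pos h, h2, Nat.lt_of_lt_of_le Nat.zero_lt_one h1]

/-- What a surviving run proves about the word: no lamplighter or exactly one, according to the
first flag, and a nonblank last letter if the second is set. Beyond the word, cells count as
`blank`. -/
theorem eval_automaton {x : List Cell} {s l : Bool} (h : automaton.eval x = some (s, l)) :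
    (s = false → ∀ (i : ℕ) d, ((x[i]?.getD blank) d).2 = false) ∧
    (s = true → ∃ c j, ∀ (i : ℕ) d, ((x[i]?.getD blank) d).2 = decide (c = d ∧ j = i)) ∧
    (l = true → x ≠ [] ∧ x[x.length - 1]?.getD blank ≠ blank) := by
  induction x using List.reverseRecOn generalizing s l with
  | nil =>
    simp only [DFA.eval_nil, automaton, Option.some.injEq, Prod.mk.injEq] at h
    obtain ⟨rfl, rfl⟩ := h
    simp [blank]
  | append_singleton x a ih =>
    have hget (i : ℕ) : (x ++ [a])[i]?.getD blank =
        if i = x.length then a else x[i]?.getD blank := by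
      rw [List.getElem?_append]
      rcases lt_trichotomy i x.length with h | h | h
      · rw [if_pos h, if_neg h.ne]
      · subst h; simp
      · rw [if_neg h.not_gt, if_neg h.ne', List.getElem?_eq_none h.le,
          List.getElem?_eq_none (by simp; omega)]
    rw [DFA.eval_append_singleton] at h
    rcases hq : automaton.eval x with _ | ⟨s', l'⟩
    · rw [hq] at h
      simp [automaton] at h
    rw [hq] at h
    obtain ⟨ih1, ih2, -⟩ := ih hq
    have hl : l = decide (a ≠ blank) := by
      cases s' <;> rcases h1 : (a true).2 <;> rcases h2 : (a false).2 <;>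
        simp [automaton, h1, h2] at h <;> simp [h.2]
    refine ⟨?_, ?_, ?_⟩
    · rintro rfl i d
      rw [hget]
      cases s' <;> rcases h1 : (a true).2 <;> rcases h2 : (a false).2 <;>
        simp [automaton, h1, h2] at h
      split_ifs
      · cases d <;> assumption
      · exact ih1 rfl i d
    · rintro rfl
      simp only [hget]
      cases s' with
      | false =>
        have ih1 := ih1 rfl
        have : ∃ c, ∀ d, (a d).2 = decide (c = d) := by
          rcases h1 : (a true).2 <;> rcases h2 : (a false).2 <;>
            simp [automaton, h1, h2] at h
          · exact ⟨false, fun d => by cases d <;> simp [h1, h2]⟩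
          · exact ⟨true, fun d => by cases d <;> simp [h1, h2]⟩
        obtain ⟨c, hc⟩ := this
        refine ⟨c, x.length, fun i d => ?_⟩
        split_ifs with hi
        · simp [hc, hi]
        · simp [ih1, Ne.symm hi]
      | true =>
        obtain ⟨c, j, hj⟩ := ih2 rfl
        refine ⟨c, j, fun i d => ?_⟩
        -- The lamplighter already seen lies inside `x`, as the default cell beyond it is `blank`.
        have hjx : j ≠ x.length := by
          rintro rfl
          have := hj x.length c
          simp [blank] at this
        split_ifs with hi
        · subst hi
          rcases h1 : (a true).2 <;> rcases h2 : (a false).2 <;>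
            simp [automaton, h1, h2] at h
          cases d <;> simp [h1, h2, hjx]
        · exact hj i d
    · rintro rfl
      refine ⟨by simp, ?_⟩
      rw [hget, if_pos (by simp)]
      simpa using hl.symm

theorem exists_encode_eq {x : List Cell} (hx : x ∈ automaton.accepts) : ∃ g, encode g = x := by
  have hx : automaton.eval x = some (true, true) := hx
  obtain ⟨-, h2, h3⟩ := eval_automaton hx
  obtain ⟨c, j, hj⟩ := h2 rfl
  obtain ⟨hne, hlast⟩ := h3 rfl
  have hpos : 0 < x.length := List.length_pos_iff.2 hne
  -- The lamps are read off by unfolding the word.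
  let f : ℤ → ZMod 2 := fun z =>
    if 0 ≤ z then ((x[z.toNat]?.getD blank) true).1 else ((x[(-z - 1).toNat]?.getD blank) false).1
  have hf (d : Bool) (i : ℕ) : f (site d i) = ((x[i]?.getD blank) d).1 := by
    cases d
    · simp only [f, site, Bool.false_eq_true, if_false]
      rw [if_neg (by omega)]
      rw [show (-(-(i : ℤ) - 1) - 1).toNat = i by omega]
    · simp [f, site]
  have hfin : (Function.support f).Finite := by
    refine (Set.finite_Icc (-(x.length : ℤ)) x.length).subset fun z hz => ?_
    obtain ⟨d, i, rfl⟩ := exists_site z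
    rw [Function.mem_support, hf] at hz
    have hi : i < x.length := by
      by_contra hi
      rw [List.getElem?_eq_none (not_lt.1 hi)] at hz
      exact hz rfl
    have := abs_le.1 (abs_site_le d i)
    constructor <;> omega
  have hcell (i : ℕ) : cell (mk f hfin (site c j)) i = x[i]?.getD blank := by
    funext d
    refine Prod.ext (hf d i) ?_
    rw [hj]
    simp only [cell, pos_mk, site_inj]
  have hlen : len (mk f hfin (site c j)) = x.length := by
    refine le_antisymm (len_le fun i hi => ?_) (not_lt.1 fun h => hlast ?_)
    · rw [hcell, List.getElem?_eq_none hi]; rfl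
    · rw [← hcell]
      exact cell_of_len_le (by omega)
  refine ⟨mk f hfin (site c j), List.ext_getElem? fun i => ?_⟩
  rw [encode_getElem?, hlen, hcell]
  split_ifs with h
  · rw [List.getElem?_eq_getElem h]; rfl
  · rw [List.getElem?_eq_none (not_lt.1 h)]

end Lamplighter

/-! ### Growth and average length of outputs -/

namespace TuringTransducer

variable {A : Type} {k : ℕ}

theorem wordSet_succ (T : TuringTransducer A k) (w₀ : List A) (n : ℕ) :
    T.wordSet w₀ (n + 1) =
      (fun p : List A × Fin k => T.output p.1 p.2) '' (T.wordSet w₀ n ×ˢ Set.univ) := by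
  ext v
  constructor
  · rintro ⟨w, hw, j, rfl⟩
    exact ⟨(w, j), ⟨hw, trivial⟩, rfl⟩
  · rintro ⟨⟨w, j⟩, ⟨hw, -⟩, rfl⟩
    exact ⟨w, hw, j, rfl⟩

theorem finite_wordSet (T : TuringTransducer A k) (w₀ : List A) (n : ℕ) :
    (T.wordSet w₀ n).Finite := by
  induction n with
  | zero => exact Set.finite_singleton w₀
  | succ n ih =>
    rw [wordSet_succ]
    exact (ih.prod Set.finite_univ).image _

theorem ncard_wordSet_le (T : TuringTransducer A k) (w₀ : List A) (n : ℕ) :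
    (T.wordSet w₀ n).ncard ≤ k ^ n := by
  induction n with
  | zero => exact (Set.ncard_singleton w₀).le
  | succ n ih =>
    rw [wordSet_succ, pow_succ]
    refine (Set.ncard_image_le ((T.finite_wordSet w₀ n).prod Set.finite_univ)).trans ?_
    rw [Set.ncard_prod, Set.ncard_univ, Nat.card_fin]
    exact Nat.mul_le_mul_right k ih

theorem ncard_wordSet_le_growth (T : TuringTransducer A k) (w₀ : List A) (n : ℕ) :
    (T.wordSet w₀ n).ncard ≤ T.growth w₀ n :=
  Set.ncard_le_ncard (Set.subset_biUnion_of_mem (u := T.wordSet w₀) (Set.mem_Iic.2 le_rfl))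
    ((Set.finite_Iic n).biUnion fun i _ => T.finite_wordSet w₀ i)

theorem growth_le (T : TuringTransducer A k) (hk : 2 ≤ k) (w₀ : List A) (n : ℕ) :
    T.growth w₀ n ≤ 2 * k ^ n := by
  induction n with
  | zero =>
    rw [growth, show Set.Iic 0 = {0} from Set.Iic_bot, Set.biUnion_singleton]
    exact (T.ncard_wordSet_le w₀ 0).trans (by simp)
  | succ n ih =>
    have h : ⋃ i ∈ Set.Iic (n + 1), T.wordSet w₀ i =
        (⋃ i ∈ Set.Iic n, T.wordSet w₀ i) ∪ T.wordSet w₀ (n + 1) := by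
      rw [show Set.Iic (n + 1) = insert (n + 1) (Set.Iic n) from Order.Iic_succ n,
        Set.biUnion_insert, Set.union_comm]
    have h1 := Set.ncard_union_le (⋃ i ∈ Set.Iic n, T.wordSet w₀ i) (T.wordSet w₀ (n + 1))
    have h2 := T.ncard_wordSet_le w₀ (n + 1)
    rw [← h] at h1
    change T.growth w₀ (n + 1) ≤ T.growth w₀ n + _ at h1
    have h3 : 2 * k ^ n ≤ k ^ (n + 1) := by
      rw [pow_succ']
      exact Nat.mul_le_mul_right _ hk
    omega

/-- The outputs of an encoded element are its neighbours, each obtained once, so passing from one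
multiset to the next averages `φ` by the Markov operator up to the factor `k`. The induction varies
`φ` because it is the last step that is split off. -/
theorem sum_wordMultiset {G : Type*} [Group G] {S : Finset G} (T : TuringTransducer A k)
    (s : Fin k ≃ S) {enc : G → List A} (h : ∀ g j, T.output (enc g) j = enc (g * s j)) (g₀ : G)
    (n : ℕ) (φ : List A → ℝ) :
    ((T.wordMultiset (enc g₀) n).map φ).sum =
      (k : ℝ) ^ n * (markov S)^[n] (fun g => φ (enc g)) g₀ := by
  induction n generalizing φ with
  | zero => simp [wordMultiset]
  | succ n ih =>
    have hk : S.card = k := by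
      rw [← Fintype.card_coe, ← Fintype.card_congr s, Fintype.card_fin]
    have h1 : ((T.wordMultiset (enc g₀) (n + 1)).map φ).sum =
        ((T.wordMultiset (enc g₀) n).map fun w => k * ((1 / k) * ∑ j, φ (T.output w j))).sum := by
      rw [wordMultiset, Multiset.map_bind, Multiset.sum_bind]
      refine congrArg Multiset.sum (Multiset.map_congr rfl fun w _ => ?_)
      rw [Multiset.map_map]
      rcases Nat.eq_zero_or_pos k with rfl | hk
      · simp
      · have : (k : ℝ) ≠ 0 := by positivity
        field_simp
        rfl
    rw [h1, Multiset.sum_map_mul_left, ih, Function.iterate_succ_apply, ← mul_assoc, ← pow_succ']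
    have hφ : (fun g => (1 / (k : ℝ)) * ∑ j, φ (T.output (enc g) j)) =
        markov S fun g => φ (enc g) := by
      funext g
      rw [markov, hk, ← Finset.sum_coe_sort S, ← s.sum_comp]
      simp only [h]
    rw [hφ]

end TuringTransducer

namespace Lamplighter

open TuringTransducer

theorem asymp_avgLength {A : Type} {T : TuringTransducer A 8} (s : Fin 8 ≃ S₁)
    {enc : Lamplighter → List A} (h : ∀ g j, T.output (enc g) j = enc (g * s j))
    (hlen : ∀ g, (enc g).length = len g) (g₀ : Lamplighter) :
    Asymp (T.avgLength (enc g₀)) fun n => Real.sqrt n := by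
  have havg (n : ℕ) : T.avgLength (enc g₀) n = (markov S₁)^[n] (fun g => (len g : ℝ)) g₀ := by
    have := T.sum_wordMultiset s h g₀ n fun w => (w.length : ℝ)
    have h2 : (((T.wordMultiset (enc g₀) n).map List.length).sum : ℝ) =
        ((T.wordMultiset (enc g₀) n).map fun w => (w.length : ℝ)).sum := by
      rw [Nat.cast_multiset_sum, Multiset.map_map]; rfl
    rw [avgLength, h2, this]
    simp only [hlen, Nat.cast_ofNat]
    field_simp
  obtain ⟨M, hM⟩ := exists_within g₀
  set b : ℝ := |(pos g₀ : ℝ)| with hb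
  have hb0 : 0 ≤ b := abs_nonneg _
  have hQ : (0 : ℝ) ≤ maximalForm (pos g₀) M := by
    exact_mod_cast (sq_nonneg M).trans (sq_le_maximalForm _ _)
  -- Since `len g ≥ 1`, the distance of `pos g` from `pos g₀` is at most `len g + b ≤ (1 + b) * len
  -- g`; the factor allows the lower bound to be used from an arbitrary start.
  have hscale (n : ℕ) : (markov S₁)^[n] (fun g => (1 + b) * (len g : ℝ)) g₀ =
      (1 + b) * (markov S₁)^[n] (fun g => (len g : ℝ)) g₀ := by
    simp only [markov_iterate_eq_sum, ← Finset.mul_sum]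
    ring
  have hlow (n : ℕ) (hn : 1 ≤ n) :
      9 / 16 * Real.sqrt n ≤ (1 + b) * (markov S₁)^[n] (fun g => (len g : ℝ)) g₀ := by
    rw [← hscale]
    refine le_markov_iterate_sqrt (b₀ := pos g₀) (fun g => ?_) rfl n hn
    have h1 : |(pos g : ℝ)| ≤ len g := by exact_mod_cast abs_pos_le_len g
    have h2 : (1 : ℝ) ≤ len g := by exact_mod_cast one_le_len g
    have h3 := abs_sub (pos g : ℝ) (pos g₀)
    nlinarith
  have hup (n : ℕ) (hn : 1 ≤ n) : (markov S₁)^[n] (fun g => (len g : ℝ)) g₀ ≤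
      1 * (maximalForm (pos g₀) M + 4) * Real.sqrt n :=
    markov_iterate_le_sqrt zero_le_one (fun g M hg => by
      have : ((len g : ℤ) : ℝ) ≤ (M + 1 : ℤ) := by exact_mod_cast hg.len_le
      push_cast at this
      linarith) hM n hn
  refine ⟨9 / 16 / (1 + b), 1 * (maximalForm (pos g₀) M + 4), by positivity, ?_, fun n hn => ?_⟩
  · rw [div_le_iff₀ (by positivity)]
    nlinarith
  · rw [havg]
    refine ⟨?_, hup n hn⟩
    rw [div_mul_eq_mul_div, div_le_iff₀ (by positivity)]
    linarith [hlow n hn]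

theorem encode_prod_mem_wordSet {A : Type} {T : TuringTransducer A 8} (s : Fin 8 ≃ S₁)
    {enc : Lamplighter → List A} (h : ∀ g j, T.output (enc g) j = enc (g * s j))
    (g₀ : Lamplighter) (l : List Lamplighter) (hl : ∀ a ∈ l, a ∈ S₁) :
    enc (g₀ * l.prod) ∈ T.wordSet (enc g₀) l.length := by
  induction l using List.reverseRecOn with
  | nil => simp [wordSet]
  | append_singleton l a ih =>
    rw [List.length_append, List.length_singleton]
    refine ⟨_, ih fun b hb => hl b (by simp [hb]), s.symm ⟨a, hl a (by simp)⟩, ?_⟩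
    rw [h, Equiv.apply_symm_apply, List.prod_append, List.prod_singleton, mul_assoc]

/-- Walks of `n` steps to the right realise all `2 ^ n` patterns on the lamps `1, …, n`, and left
translation by `g₀` keeps them distinct. -/
theorem two_pow_le_ncard_wordSet {A : Type} {T : TuringTransducer A 8} (s : Fin 8 ≃ S₁)
    {enc : Lamplighter → List A} (h : ∀ g j, T.output (enc g) j = enc (g * s j))
    (henc : Function.Injective enc) (g₀ : Lamplighter) (n : ℕ) :
    2 ^ n ≤ (T.wordSet (enc g₀) n).ncard := by
  have key (f : Fin n → ZMod 2) : ∃ l : List Lamplighter, l.length = n ∧ (∀ a ∈ l, a ∈ S₁) ∧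
      ∀ i : Fin n, lamp l.prod (i + 1) = f i := by
    obtain ⟨l, h1, h2, -, h4⟩ := exists_list_of_lamps
      (fun x => if hx : (x - 1).toNat < n then f ⟨(x - 1).toNat, hx⟩ else 0) n
    refine ⟨l, h1, h2, fun i => ?_⟩
    rw [h4, if_pos (by omega), dif_pos (by simp)]
    simp
  choose l h1 h2 h3 using key
  have hinj : Function.Injective fun f => enc (g₀ * (l f).prod) := fun f f' hf => by
    have := mul_left_cancel (henc hf)
    funext i
    rw [← h3 f, ← h3 f', this]
  calc 2 ^ n = (Set.range fun f => enc (g₀ * (l f).prod)).ncard := by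
        rw [← Set.image_univ, Set.ncard_image_of_injective _ hinj, Set.ncard_univ]
        simp
    _ ≤ _ := Set.ncard_le_ncard (by
        rintro _ ⟨f, rfl⟩
        have := encode_prod_mem_wordSet s h g₀ (l f) (h2 f)
        rwa [h1] at this) (T.finite_wordSet _ n)

theorem exponentialGrowth {A : Type} {T : TuringTransducer A 8} (s : Fin 8 ≃ S₁)
    {enc : Lamplighter → List A} (h : ∀ g j, T.output (enc g) j = enc (g * s j))
    (henc : Function.Injective enc) (g₀ : Lamplighter) :
    ExponentialGrowth (T.growth (enc g₀)) := by
  refine ⟨2, 8, 1, 2, by norm_num, by norm_num, by norm_num, by norm_num, fun n => ⟨?_, ?_⟩⟩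
  · rw [one_mul]
    exact_mod_cast (two_pow_le_ncard_wordSet s h henc g₀ n).trans (T.ncard_wordSet_le_growth _ n)
  · exact_mod_cast T.growth_le (by norm_num) (enc g₀) n

end Lamplighter

/-! ### The transducer and its presentation of the Cayley graph -/

open Lamplighter TuringTransducer in
theorem exists_transducer (s : Fin 8 ≃ S₁) :
    ∃ T : TuringTransducer Cell 8, T.InClass ∧ T.language = Set.range encode ∧
      ∀ g, T.Translates (encode g) fun j => encode (g * s j) := by
  choose e α β hs using fun j => mem_S₁.1 (s j).2
  have hloc (g : Lamplighter) (j : Fin 8) (p : ℕ) : (encode (g * s j))[p]? =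
      localImage (localRule (e j) (α j) (β j)) (encode g) p := by
    rw [localImage_encode, ← hs]
  refine ⟨sweep automaton (fun j => localRule (e j) (α j) (β j)) 0,
    sweep_inClass _ _ _ fun x hx => ?_, Set.ext fun x => ?_, fun g => ?_⟩
  · obtain ⟨g, rfl⟩ := exists_encode_eq hx
    exact ⟨fun j => encode (g * s j), fun j => hloc g j, fun j => encode_mem_accepts _⟩
  · rw [mem_sweep_language]
    exact ⟨exists_encode_eq, fun ⟨g, hg⟩ => hg ▸ encode_mem_accepts g⟩
  · exact sweep_translates _ (encode_mem_accepts g) fun j => hloc g j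

theorem TuringTransducer.presents_of_encoding {A : Type} {k : ℕ} {G : Type*} [Group G]
    {T : TuringTransducer A k} {s : Fin k → G} {enc : G → List A}
    (henc : Function.Injective enc) (hL : T.language = Set.range enc)
    (hT : ∀ g, T.Translates (enc g) fun j => enc (g * s j)) : T.Presents s := by
  let ψ : G ≃ T.language := (Equiv.ofInjective enc henc).trans (Equiv.setCongr hL.symm)
  have hψ (g : G) : (ψ g : List A) = enc g := rfl
  refine ⟨ψ.symm, fun j u v => ?_⟩
  obtain ⟨g, rfl⟩ := ψ.surjective u
  obtain ⟨g', rfl⟩ := ψ.surjective v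
  rw [Equiv.symm_apply_apply, Equiv.symm_apply_apply]
  constructor
  · rintro ⟨w, hw, hj⟩
    rw [← (hT g).unique hw] at hj
    exact (henc hj).symm
  · rintro rfl
    exact ⟨_, hT g, rfl⟩

theorem lemma3 :
    Subgroup.closure (Lamplighter.S₁ : Set Lamplighter) = ⊤ ∧
    Lamplighter.S₁.card = 8 ∧
    Asymp (drift Lamplighter.S₁) (fun n => Real.sqrt n) ∧
    ∀ s : Fin 8 ≃ Lamplighter.S₁,
      ∃ (A : Type) (_ : Finite A) (T : TuringTransducer A 8),
        T.InClass ∧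
        T.Presents (fun j => (s j : Lamplighter)) ∧
        ∀ w₀ ∈ T.language,
          Asymp (T.avgLength w₀) (fun n => Real.sqrt n) ∧
          ExponentialGrowth (T.growth w₀) := by
  refine ⟨Lamplighter.closure_S₁, Lamplighter.card_S₁, Lamplighter.asymp_drift, fun s => ?_⟩
  obtain ⟨T, hclass, hL, hT⟩ := exists_transducer s
  have hout (g : Lamplighter) (j : Fin 8) :
      T.output (Lamplighter.encode g) j = Lamplighter.encode (g * s j) := by
    rw [(hT g).output_eq]
  refine ⟨Lamplighter.Cell, inferInstance, T, hclass,
    TuringTransducer.presents_of_encoding Lamplighter.encode_injective hL hT, fun w₀ hw₀ => ?_⟩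
  rw [hL] at hw₀
  obtain ⟨g₀, rfl⟩ := hw₀
  exact ⟨Lamplighter.asymp_avgLength s hout Lamplighter.length_encode g₀,
    Lamplighter.exponentialGrowth s hout Lamplighter.encode_injective g₀⟩
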